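/- Let $G_n$ be a simple graph with vertex set $[n]=\{1,\dots,n\}$ and edge set $E_n$. For $A\subseteq[n]$ let $\partial_e A$ be the set of edges with one endpoint in $A$ and the other outside $A$, and let $$i_e(G_n)=\min_{\substack{A\subset[n]\\ 1\le|A|\le n/2}}\frac{|\partial_eA|}{|A|},\qquad i_e'(G_n)=\min_{\substack{A\subset[n]\\ |A|=\lfloor n/2\rfloor}}\frac{|\partial_eA|}{|A|}\qquad(n\ge 2).$$ For $\sigma\in\{-1,+1\}^{[n]}$ and $h>0$ let $H(\sigma)=-\sum_{(i,j)\in E_n}\sigma_i\sigma_j-h\sum_{i\in[n]}\sigma_i$. Let $\boxminus$ and $\boxplus$ be the all minus and the all plus configuration, and let $\Phi(\sigma,\sigma')=\min_\omega\max_{\sigma''\in\omega}H(\sigma'')$, where the minimum is over all finite sequences $\omega$ of configurations, with at least one step, that lead from $\sigma$ to $\sigma'$ and in which consecutive configurations differ at exactly one vertex. **(a)** For every integer $r\ge0$ and real $h>0$ there is $n_0=n_0(r,h)$ such that, for every $n\ge n_0$ and every connected $r$-regular graph $G_n$ on $[n]$ with $h<i_e(G_n)$, $$\Phi(\boxminus,\boxplus)-H(\boxminus)\le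 (i_e'(G_n)-h)\,n+2(r-2+h)\left\lceil\frac{r+h-2i_e(G_n)}{r-h}\,\frac n2\right\rceil .$$ **(b)** There are absolute constants $C_0>0$ and $C_2<\infty$ such that, for every integer $r\ge0$ and every fixed real $h$ with $0<h<C_0\sqrt r$, the following holds. If $G_n$ is chosen uniformly at random from all simple $r$-regular graphs on $[n]$, then the probability of $$\Phi(\boxminus,\boxplus)-H(\boxminus)\le\left(\tfrac r2+C_2\sqrt r\right)n$$ tends to $1$ as $n\to\infty$ along the integers $n>r$ with $nr$ even. -/

import Mathlib

namespace IsingRegular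

open Classical in
/-- The graph `G` on the vertex set `[n]` is `r`-regular. -/
def IsRegular {n : ℕ} (G : SimpleGraph (Fin n)) (r : ℕ) : Prop :=
  G.IsRegularOfDegree r

open Classical in
/-- The edge boundary of `A`: the edges `(i, j)` with `i ∈ A` and `j ∉ A`. Every boundary edge
occurs exactly once, oriented from `A` to its complement. -/
noncomputable def edgeBoundary {n : ℕ} (G : SimpleGraph (Fin n)) (A : Finset (Fin n)) :
    Finset (Fin n × Fin n) :=
  {p : Fin n × Fin n | G.Adj p.1 p.2 ∧ p.1 ∈ A ∧ p.2 ∉ A}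

/-- The isoperimetric number: the minimum of `|∂A| / |A|` over nonempty `A` with `|A| ≤ n / 2`.
For `n ≥ 2` the infimum is over a finite nonempty set of reals, hence a minimum. -/
noncomputable def isoNumber {n : ℕ} (G : SimpleGraph (Fin n)) : ℝ :=
  sInf {x : ℝ | ∃ A : Finset (Fin n), A.Nonempty ∧ 2 * A.card ≤ n ∧
    x = ((edgeBoundary G A).card : ℝ) / (A.card : ℝ)}

/-- The minimum of `|∂A| / |A|` over the sets `A` with `|A| = ⌊n / 2⌋` (of interest for `n ≥ 2`). -/
noncomputable def bisectionNumber {n : ℕ} (G : SimpleGraph (Fin n)) : ℝ :=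
  sInf {x : ℝ | ∃ A : Finset (Fin n), A.card = n / 2 ∧
    x = ((edgeBoundary G A).card : ℝ) / (A.card : ℝ)}

/-- Spin configurations: every vertex of `[n]` carries a spin in `{1, -1} = ℤˣ`. -/
abbrev Config (n : ℕ) : Type := Fin n → ℤˣ

/-- The real number `σ_i ∈ {1, -1}`. -/
def spin {n : ℕ} (σ : Config n) (i : Fin n) : ℝ := ((σ i : ℤ) : ℝ)

/-- The product `σ_i σ_j` of the two spins at the ends of an edge. -/
def edgeSpin {n : ℕ} (σ : Config n) : Sym2 (Fin n) → ℝ :=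
  Sym2.lift ⟨fun i j => spin σ i * spin σ j, fun _ _ => mul_comm _ _⟩

open Classical in
/-- The Ising Hamiltonian with interaction constant `1` and external field `h`. -/
noncomputable def hamiltonian {n : ℕ} (G : SimpleGraph (Fin n)) (h : ℝ) (σ : Config n) : ℝ :=
  -(∑ e ∈ G.edgeFinset, edgeSpin σ e) - h * ∑ i, spin σ i

/-- The all minus configuration. -/
def allMinus (n : ℕ) : Config n := fun _ => -1

/-- The all plus configuration. -/
def allPlus (n : ℕ) : Config n := fun _ => 1

/-- `ω 0, …, ω ℓ` is a path of `ℓ ≥ 1` single spin flips from `σ` to `σ'`: consecutive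
configurations differ at exactly one vertex. The values `ω k` with `k > ℓ` play no role. -/
def IsPath {n : ℕ} (σ σ' : Config n) (ℓ : ℕ) (ω : ℕ → Config n) : Prop :=
  1 ≤ ℓ ∧ ω 0 = σ ∧ ω ℓ = σ' ∧ ∀ k < ℓ, hammingDist (ω k) (ω (k + 1)) = 1

/-- The largest energy among `ω 0, …, ω ℓ`. -/
noncomputable def pathHeight {n : ℕ} (G : SimpleGraph (Fin n)) (h : ℝ) (ℓ : ℕ)
    (ω : ℕ → Config n) : ℝ :=
  (Finset.range (ℓ + 1)).sup' Finset.nonempty_range_add_one fun k => hamiltonian G h (ω k)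

/-- The communication height `Φ(σ, σ')`: the minimum over all paths from `σ` to `σ'` of the
largest energy on the path. There are finitely many energies and, for `n ≥ 1`, there is a path
between any two configurations, so that the infimum is a minimum. -/
noncomputable def commHeight {n : ℕ} (G : SimpleGraph (Fin n)) (h : ℝ) (σ σ' : Config n) : ℝ :=
  sInf {x : ℝ | ∃ (ℓ : ℕ) (ω : ℕ → Config n), IsPath σ σ' ℓ ω ∧ x = pathHeight G h ℓ ω}

/-- The law of the random `r`-regular graph: the uniform distribution on the simple `r`-regular
graphs with vertex set `[n]`. (This finite space carries Mathlib's `σ`-algebra, generated by the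
adjacency events, in which every set of graphs is measurable.) -/
noncomputable def randomRegular (r n : ℕ) : MeasureTheory.Measure (SimpleGraph (Fin n)) :=
  ProbabilityTheory.uniformOn {G : SimpleGraph (Fin n) | IsRegular G r}

/-- The event `P n` holds with high probability for the random `r`-regular graph on `[n]`: its
probability tends to `1` as `n → ∞` along the `n > r` with `n r` even. -/
def WithHighProb (r : ℕ) (P : (n : ℕ) → SimpleGraph (Fin n) → Prop) : Prop :=
  Filter.Tendsto (fun n : ℕ => randomRegular r n {G | P n G})
    (Filter.atTop ⊓ Filter.principal {n : ℕ | r < n ∧ Even (n * r)}) (nhds 1)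

end IsingRegular

namespace IsingRegular

open Finset Relation

variable {n : ℕ}

/-! Relative to all minus, the plus set `A` has energy `2|∂A| - 2h|A|`, so the barrier is bounded by
growing `A` from `∅` to `univ` one vertex at a time.

(b) is deterministic. Adding a vertex outside `A` with at least the average number of neighbours in
`A` keeps `|∂A|` at most `r k (n - k) / (n - 1)`, its mean over `k`-sets. Hence every regular graph
has a path of height at most `r n² / (2 (n - 1))` (`exists_reflTransGen_card_eq`), which is below
the bound because `r ≤ n - 1`.

(a) routes the path through an optimal bisection `A₀`, moving down to `∅` and up to `univ`. By
connectivity some flip costs at most `2 (r - 2 + h)`; this price is paid for at most the first `K`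
flips each way. Afterwards a flip that does not raise the energy is used if there is one. If there
is none, the set is a strict local minimum in that direction, which bounds its energy by that of
`A₀`, so one costly flip still fits under the ceiling (`reflTransGen_empty`, `reflTransGen_univ`).
-/

/-! ### Edge boundaries and degrees -/

open Classical in
/-- The number of neighbours of `v` in `A`. -/
noncomputable def degreeIn (G : SimpleGraph (Fin n)) (v : Fin n) (A : Finset (Fin n)) : ℕ :=
  #{w ∈ A | G.Adj v w}

open Classical in
theorem degreeIn_add_degreeIn_compl {G : SimpleGraph (Fin n)} {r : ℕ} (hG : IsRegular G r)
    (v : Fin n) (A : Finset (Fin n)) : degreeIn G v A + degreeIn G v Aᶜ = r := by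
  have h := hG v
  rw [← SimpleGraph.card_neighborFinset_eq_degree] at h
  rw [degreeIn, degreeIn, ← card_union_of_disjoint, ← filter_union, union_compl]
  · rw [← h]; congr 1; ext w; simp
  · exact disjoint_filter_filter disjoint_compl_right

open Classical in
theorem card_edgeBoundary_eq_sum_compl (G : SimpleGraph (Fin n)) (A : Finset (Fin n)) :
    #(edgeBoundary G A) = ∑ v ∈ Aᶜ, degreeIn G v A := by
  rw [card_eq_sum_card_fiberwise (f := Prod.snd) (t := Aᶜ)]
  · refine sum_congr rfl fun v hv => ?_
    rw [degreeIn]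
    refine card_nbij' Prod.fst (fun w => (w, v)) ?_ ?_ ?_ ?_
    · rintro ⟨a, b⟩ h; simp [edgeBoundary] at h ⊢
      obtain ⟨⟨h1, h2, h3⟩, rfl⟩ := h; exact ⟨h2, h1.symm⟩
    · intro w h; simp [edgeBoundary] at h hv ⊢; exact ⟨h.2.symm, h.1, hv⟩
    · rintro ⟨a, b⟩ h; simp [edgeBoundary] at h ⊢; exact h.2.symm
    · intro w _; rfl
  · rintro ⟨a, b⟩ h; simp [edgeBoundary] at h ⊢; exact h.2.2

open Classical in
theorem card_edgeBoundary_eq_sum (G : SimpleGraph (Fin n)) (A : Finset (Fin n)) :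
    #(edgeBoundary G A) = ∑ v ∈ A, degreeIn G v Aᶜ := by
  rw [card_eq_sum_card_fiberwise (f := Prod.fst) (t := A)]
  · refine sum_congr rfl fun v hv => ?_
    rw [degreeIn]
    refine card_nbij' Prod.snd (fun w => (v, w)) ?_ ?_ ?_ ?_
    · rintro ⟨a, b⟩ h; simp [edgeBoundary] at h ⊢
      obtain ⟨⟨h1, h2, h3⟩, rfl⟩ := h; exact ⟨h3, h1⟩
    · intro w h; simp [edgeBoundary] at h hv ⊢; exact ⟨h.2, hv, h.1⟩
    · rintro ⟨a, b⟩ h; simp [edgeBoundary] at h ⊢; exact h.2.symm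
    · intro w _; rfl
  · rintro ⟨a, b⟩ h; simp [edgeBoundary] at h ⊢; exact h.2.1

open Classical in
theorem degreeIn_insert_self (G : SimpleGraph (Fin n)) (v : Fin n) (A : Finset (Fin n)) :
    degreeIn G v (insert v A) = degreeIn G v A := by
  simp [degreeIn, filter_insert]

open Classical in
theorem degreeIn_compl_insert (G : SimpleGraph (Fin n)) {v : Fin n} {A : Finset (Fin n)}
    (hv : v ∉ A) (u : Fin n) :
    degreeIn G u (insert v A)ᶜ + (if G.Adj u v then 1 else 0) = degreeIn G u Aᶜ := by
  have : Aᶜ = insert v (insert v A)ᶜ := by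
    ext w; by_cases h : w = v <;> simp_all
  conv_rhs => rw [this]
  rw [degreeIn, degreeIn, filter_insert]
  split_ifs
  · rw [card_insert_of_notMem (by simp)]
  · rfl

open Classical in
theorem card_edgeBoundary_insert {G : SimpleGraph (Fin n)} {r : ℕ} (hG : IsRegular G r)
    {v : Fin n} {A : Finset (Fin n)} (hv : v ∉ A) :
    #(edgeBoundary G (insert v A)) + 2 * degreeIn G v A = #(edgeBoundary G A) + r := by
  have hc := degreeIn_add_degreeIn_compl hG v (insert v A)
  have hs : ∑ u ∈ A, degreeIn G u Aᶜ = ∑ u ∈ A, degreeIn G u (insert v A)ᶜ + degreeIn G v A := by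
    rw [← sum_congr rfl fun u _ => degreeIn_compl_insert G hv u, sum_add_distrib]
    congr 1
    rw [degreeIn, card_filter]
    simp [SimpleGraph.adj_comm]
  rw [card_edgeBoundary_eq_sum, card_edgeBoundary_eq_sum, sum_insert hv, hs]
  rw [degreeIn_insert_self] at hc
  omega

/-! ### Energy as a function of the plus set -/

/-- The energy of the configuration with plus spins on `A`, relative to the all minus
configuration, see `hamiltonian_plusOn`. -/
noncomputable def energy (G : SimpleGraph (Fin n)) (h : ℝ) (A : Finset (Fin n)) : ℝ :=
  2 * (#(edgeBoundary G A) : ℝ) - 2 * h * (#A : ℝ)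

/-- The configuration with plus spins exactly on `A`. -/
def plusOn (A : Finset (Fin n)) : Config n := fun i => if i ∈ A then 1 else -1

theorem plusOn_empty : plusOn (∅ : Finset (Fin n)) = allMinus n := by
  ext; simp [plusOn, allMinus]

theorem plusOn_univ : plusOn (univ : Finset (Fin n)) = allPlus n := by
  ext; simp [plusOn, allPlus]

theorem spin_plusOn (A : Finset (Fin n)) (i : Fin n) :
    spin (plusOn A) i = if i ∈ A then 1 else -1 := by
  by_cases h : i ∈ A <;> simp [spin, plusOn, h]

open Classical in
theorem sum_one_sub_edgeSpin (G : SimpleGraph (Fin n)) (A : Finset (Fin n)) :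
    ∑ e ∈ G.edgeFinset, (1 - edgeSpin (plusOn A) e) = 2 * (#(edgeBoundary G A) : ℝ) := by
  rw [mul_comm, ← nsmul_eq_mul, ← sum_const]
  symm
  -- Cut edges contribute 2 and all others 0; forgetting the orientation is injective on pairs
  -- leading out of `A`.
  refine sum_of_injOn (fun p => s(p.1, p.2)) ?_ ?_ ?_ ?_
  · rintro ⟨a, b⟩ hp ⟨c, d⟩ hq heq
    simp [edgeBoundary] at hp hq heq
    rcases heq with h | ⟨rfl, rfl⟩
    · simp [h]
    · exact absurd hp.2.1 hq.2.2
  · rintro ⟨a, b⟩ hp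
    simp [edgeBoundary] at hp ⊢
    exact hp.1
  · intro e
    induction e with
    | _ i j =>
      intro he hn
      simp only [SimpleGraph.mem_edgeFinset, SimpleGraph.mem_edgeSet] at he
      simp only [edgeSpin, Sym2.lift_mk, spin_plusOn]
      have h1 : ¬ (i ∈ A ∧ j ∉ A) := fun h => hn ⟨(i, j), by simp [edgeBoundary, he, h], rfl⟩
      have h2 : ¬ (j ∈ A ∧ i ∉ A) := fun h =>
        hn ⟨(j, i), by simp [edgeBoundary, he.symm, h], Sym2.eq_swap⟩
      by_cases hi : i ∈ A <;> by_cases hj : j ∈ A <;> simp_all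
  · rintro ⟨a, b⟩ hp
    simp [edgeBoundary] at hp
    simp [edgeSpin, spin_plusOn, hp]
    norm_num

theorem sum_spin_plusOn (A : Finset (Fin n)) :
    ∑ i, spin (plusOn A) i = 2 * (#A : ℝ) - n := by
  have : ∀ i, spin (plusOn A) i = 2 * (if i ∈ A then 1 else 0) - 1 := fun i => by
    rw [spin_plusOn]; split_ifs <;> norm_num
  simp [this, mul_comm]

theorem hamiltonian_plusOn (G : SimpleGraph (Fin n)) (h : ℝ) (A : Finset (Fin n)) :
    hamiltonian G h (plusOn A) = hamiltonian G h (allMinus n) + energy G h A := by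
  classical
  have e : ∀ B : Finset (Fin n), hamiltonian G h (plusOn B) =
      energy G h B - #G.edgeFinset + h * n := fun B => by
    have := sum_one_sub_edgeSpin G B
    rw [sum_sub_distrib, sum_const, nsmul_one] at this
    rw [hamiltonian, sum_spin_plusOn, energy, ← this]
    ring_nf
  have e0 : energy G h ∅ = 0 := by simp [energy, edgeBoundary]
  rw [e, ← plusOn_empty, e, e0]; ring

/-! ### Monotone flip paths and the communication height -/

/-- The single spin flips to a plus spin between configurations of energy at most `M`. -/
def UpStep (G : SimpleGraph (Fin n)) (h M : ℝ) (A B : Finset (Fin n)) : Prop :=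
  (∃ v ∉ A, B = insert v A) ∧ energy G h A ≤ M ∧ energy G h B ≤ M

theorem hammingDist_plusOn_insert {A : Finset (Fin n)} {v : Fin n} (hv : v ∉ A) :
    hammingDist (plusOn A) (plusOn (insert v A)) = 1 := by
  rw [hammingDist, card_eq_one]
  refine ⟨v, ?_⟩
  ext w
  by_cases h : w = v
  · subst h; simp [plusOn, hv]
  · simp [plusOn, h]

theorem exists_seq_of_reflTransGen {α : Type*} {R : α → α → Prop} {a b : α}
    (h : ReflTransGen R a b) :
    ∃ (l : ℕ) (f : ℕ → α), f 0 = a ∧ f l = b ∧ ∀ k < l, R (f k) (f (k + 1)) := by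
  induction h with
  | refl => exact ⟨0, fun _ => a, rfl, rfl, by simp⟩
  | @tail b c _ hbc ih =>
    obtain ⟨l, f, h0, hl, hf⟩ := ih
    refine ⟨l + 1, fun k => if k ≤ l then f k else c, by simp [h0], by simp, fun k hk => ?_⟩
    rcases Nat.lt_succ_iff_lt_or_eq.1 hk with h | rfl
    · simpa [h.le, Nat.succ_le_of_lt h] using hf k h
    · simpa [hl] using hbc

theorem commHeight_sub_le {G : SimpleGraph (Fin n)} {h M : ℝ} (hn : 0 < n)
    (H : ReflTransGen (UpStep G h M) ∅ univ) :
    commHeight G h (allMinus n) (allPlus n) - hamiltonian G h (allMinus n) ≤ M := by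
  obtain ⟨l, f, h0, hl, hf⟩ := exists_seq_of_reflTransGen H
  have hl0 : 1 ≤ l := by
    rcases Nat.eq_zero_or_pos l with rfl | h
    · rw [h0] at hl
      have : (⟨0, hn⟩ : Fin n) ∈ (∅ : Finset (Fin n)) := hl ▸ mem_univ _
      simp at this
    · exact h
  have hM : ∀ k ≤ l, energy G h (f k) ≤ M := fun k hk => by
    rcases hk.lt_or_eq with h' | rfl
    · exact (hf k h').2.1
    · obtain ⟨j, rfl⟩ := Nat.exists_eq_add_of_le' hl0
      exact (hf j (by omega)).2.2
  have hb : BddBelow {x : ℝ | ∃ (ℓ : ℕ) (ω : ℕ → Config n),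
      IsPath (allMinus n) (allPlus n) ℓ ω ∧ x = pathHeight G h ℓ ω} := by
    obtain ⟨c, hc⟩ := (Set.finite_range (hamiltonian G h)).bddBelow
    refine ⟨c, ?_⟩
    rintro _ ⟨ℓ, ω, -, rfl⟩
    exact (hc ⟨ω 0, rfl⟩).trans
      (le_sup' (fun k => hamiltonian G h (ω k)) (mem_range.2 (Nat.succ_pos ℓ)))
  have : commHeight G h (allMinus n) (allPlus n) ≤ pathHeight G h l fun k => plusOn (f k) := by
    refine csInf_le hb ⟨l, _, ⟨hl0, ?_, ?_, fun k hk => ?_⟩, rfl⟩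
    · simp only [h0, plusOn_empty]
    · simp only [hl, plusOn_univ]
    · obtain ⟨v, hv, e⟩ := (hf k hk).1
      simpa only [e] using hammingDist_plusOn_insert hv
  rw [sub_le_iff_le_add']
  refine this.trans (sup'_le _ _ fun k hk => ?_)
  rw [hamiltonian_plusOn]
  have := hM k (by simpa [Nat.lt_succ_iff] using hk)
  linarith

/-! ### The averaging path -/

theorem edgeBoundary_univ (G : SimpleGraph (Fin n)) : edgeBoundary G univ = ∅ := by
  simp [edgeBoundary]

theorem energy_insert {G : SimpleGraph (Fin n)} {r : ℕ} (hG : IsRegular G r) (h : ℝ)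
    {v : Fin n} {A : Finset (Fin n)} (hv : v ∉ A) :
    energy G h (insert v A) = energy G h A + 2 * (r - 2 * degreeIn G v A - h) := by
  have := card_edgeBoundary_insert hG hv
  have h' : (#(edgeBoundary G (insert v A)) : ℝ) + 2 * degreeIn G v A
      = #(edgeBoundary G A) + r := by exact_mod_cast this
  rw [energy, energy, card_insert_of_notMem hv]
  push_cast
  linarith

/-- With `t = n - |A|`, a vertex of at least average degree into `A` gives a new boundary of at most
`|∂A| (t - 2) / t + r`; inserting the assumed bound yields exactly the next one. -/
theorem exists_insert_card_edgeBoundary_le {G : SimpleGraph (Fin n)} {r : ℕ}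
    (hG : IsRegular G r) {A : Finset (Fin n)} (hA : #A < n)
    (hb : (#(edgeBoundary G A) : ℝ) * (n - 1) ≤ r * #A * (n - #A)) :
    ∃ v ∉ A, (#(edgeBoundary G (insert v A)) : ℝ) * (n - 1)
      ≤ r * (#A + 1) * (n - (#A + 1)) := by
  have hcard : #Aᶜ = n - #A := by rw [card_compl, Fintype.card_fin]
  have hne : Aᶜ.Nonempty := by rw [← card_pos, hcard]; omega
  obtain ⟨v, hv, hd⟩ : ∃ v ∈ Aᶜ, (#(edgeBoundary G A) : ℝ) / (n - #A) ≤ degreeIn G v A := by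
    refine exists_le_of_sum_le hne ?_
    rw [card_edgeBoundary_eq_sum_compl, sum_const, hcard, nsmul_eq_mul, Nat.cast_sub hA.le,
      mul_div_cancel₀]
    · push_cast; rfl
    · have : (#A : ℝ) < n := by exact_mod_cast hA
      linarith
  rw [mem_compl] at hv
  refine ⟨v, hv, ?_⟩
  rcases Nat.lt_or_ge (#A + 1) n with hlt | hge
  · have hi : (#(edgeBoundary G (insert v A)) : ℝ) + 2 * degreeIn G v A
        = #(edgeBoundary G A) + r := by exact_mod_cast card_edgeBoundary_insert hG hv
    have ht : (2 : ℝ) ≤ n - #A := by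
      have : ((#A + 2 : ℕ) : ℝ) ≤ n := by exact_mod_cast hlt
      push_cast at this; linarith
    have ht0 : (0 : ℝ) < n - #A := by linarith
    have hn1 : (0 : ℝ) ≤ n - 1 := by
      have : (0 : ℝ) ≤ #A := by positivity
      linarith
    rw [div_le_iff₀ ht0] at hd
    refine le_of_mul_le_mul_left ?_ ht0
    set b : ℝ := (#(edgeBoundary G A) : ℝ)
    have h1 := mul_le_mul_of_nonneg_left hb (sub_nonneg.2 ht)
    have h2 := mul_le_mul_of_nonneg_right hd hn1
    have h3 : (#(edgeBoundary G (insert v A)) : ℝ) = b + r - 2 * degreeIn G v A := by linarith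
    rw [h3]
    linear_combination h1 + 2 * h2
  -- For the last vertex `t - 2` is negative, but both sides vanish.
  · have hu : insert v A = univ := by
      rw [← card_eq_iff_eq_univ, card_insert_of_notMem hv, Fintype.card_fin]; omega
    have : (n : ℝ) = #A + 1 := by exact_mod_cast (by omega : n = #A + 1)
    rw [hu, edgeBoundary_univ, this]; simp

/-- Every regular graph has a path of single spin flips along which the edge boundary is at most
its average over all sets of the same size. -/
theorem exists_reflTransGen_card_eq {G : SimpleGraph (Fin n)} {r : ℕ} (hG : IsRegular G r)
    {h M : ℝ} (hh : 0 ≤ h) (hn : 2 ≤ n) (hM : (r : ℝ) * n ^ 2 ≤ 2 * (n - 1) * M)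
    {k : ℕ} (hk : k ≤ n) :
    ∃ A : Finset (Fin n), #A = k ∧ (#(edgeBoundary G A) : ℝ) * (n - 1) ≤ r * k * (n - k) ∧
      ReflTransGen (UpStep G h M) ∅ A := by
  have hn1 : (0 : ℝ) < n - 1 := by
    have : (2 : ℝ) ≤ n := by exact_mod_cast hn
    linarith
  have key : ∀ A : Finset (Fin n),
      (#(edgeBoundary G A) : ℝ) * (n - 1) ≤ r * #A * (n - #A) → energy G h A ≤ M := by
    intro A hA
    have h1 : energy G h A ≤ 2 * #(edgeBoundary G A) := by
      rw [energy]; have : 0 ≤ 2 * h * (#A : ℝ) := by positivity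
      linarith
    refine h1.trans (le_of_mul_le_mul_left ?_ hn1)
    -- This is `4k(n - k) ≤ n²`.
    have h2 : (0 : ℝ) ≤ r * (n - 2 * #A) ^ 2 := by positivity
    nlinarith
  induction k with
  | zero => exact ⟨∅, by simp, by simp [edgeBoundary], .refl⟩
  | succ k ih =>
    obtain ⟨A, rfl, hb, hp⟩ := ih (by omega)
    obtain ⟨v, hv, hb'⟩ := exists_insert_card_edgeBoundary_le hG (by omega) hb
    have hc := card_insert_of_notMem hv
    refine ⟨insert v A, hc, by push_cast; exact hb', hp.tail ⟨⟨v, hv, rfl⟩, key _ hb, key _ ?_⟩⟩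
    rw [hc]; push_cast; exact hb'

theorem commHeight_sub_le_of_isRegular {G : SimpleGraph (Fin n)} {r : ℕ} (hG : IsRegular G r)
    {h M : ℝ} (hh : 0 ≤ h) (hn : 2 ≤ n) (hM : (r : ℝ) * n ^ 2 ≤ 2 * (n - 1) * M) :
    commHeight G h (allMinus n) (allPlus n) - hamiltonian G h (allMinus n) ≤ M := by
  obtain ⟨A, hA, -, hp⟩ := exists_reflTransGen_card_eq hG hh hn hM le_rfl
  have : A = univ := by rw [← card_eq_iff_eq_univ, hA, Fintype.card_fin]
  exact commHeight_sub_le (by omega) (this ▸ hp)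

/-! ### The uniform law on regular graphs -/

/-- A circulant graph on `ℤ/n` with symmetric connection set `S`: the residues within distance `k`
of 0, and for odd `r` also the involution `n / 2`. Without existence `uniformOn` would be the zero
measure. -/
theorem exists_isRegular {r n : ℕ} (hr : r < n) (he : Even (n * r)) :
    ∃ G : SimpleGraph (Fin n), IsRegular G r := by
  classical
  have : NeZero n := ⟨by omega⟩
  suffices H : ∃ S : Finset (Fin n), #S = r ∧ (0 : Fin n) ∉ S ∧ ∀ x ∈ S, -x ∈ S by
    obtain ⟨S, hS, h0, hneg⟩ := H
    refine ⟨⟨fun a b => b - a ∈ S, ⟨fun a b h => ?_⟩, ⟨fun a h => h0 (by simpa using h)⟩⟩, ?_⟩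
    · simpa using hneg _ h
    · intro v
      rw [← SimpleGraph.card_neighborFinset_eq_degree, ← hS]
      refine card_nbij' (fun w => w - v) (fun s => s + v) ?_ ?_ ?_ ?_
      · intro w hw; simpa using hw
      · intro s hs; simpa using hs
      · intro w _; simp
      · intro s _; simp
  obtain ⟨k, rfl | rfl⟩ := Nat.even_or_odd' r
  · refine ⟨univ.filter fun x : Fin n => 1 ≤ x.val ∧ (x.val ≤ k ∨ n - k ≤ x.val), ?_, by simp, ?_⟩
    · have : #((Icc 1 k) ∪ (Ico (n - k) n)) = 2 * k := by
        rw [card_union_of_disjoint]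
        · simp; omega
        · rw [disjoint_left]; intro a; simp; omega
      rw [← this]
      refine card_nbij Fin.val ?_ (Fin.val_injective.injOn) ?_
      · intro x; simp; have := x.2; omega
      · intro a ha; simp at ha; refine ⟨⟨a, by omega⟩, by simp; omega, rfl⟩
    · intro x hx
      simp only [mem_filter, mem_univ, true_and] at hx ⊢
      have hx0 : x ≠ 0 := by rintro rfl; simp at hx
      rw [Fin.val_neg, if_neg hx0]
      have := x.2
      omega
  · have hn : Even n := by
      rcases Nat.even_mul.1 he with h | h
      · exact h
      · exact absurd h (by simp)
    obtain ⟨m, rfl⟩ := hn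
    refine ⟨univ.filter fun x : Fin (m + m) => 1 ≤ x.val ∧
      (x.val ≤ k ∨ x.val = m ∨ m + m - k ≤ x.val), ?_, by simp, ?_⟩
    · have : #((Icc 1 k) ∪ ({m} ∪ Ico (m + m - k) (m + m))) = 2 * k + 1 := by
        rw [card_union_of_disjoint, card_union_of_disjoint]
        · simp; omega
        · rw [disjoint_left]; intro a; simp; omega
        · rw [disjoint_left]; intro a; simp; omega
      rw [← this]
      refine card_nbij Fin.val ?_ (Fin.val_injective.injOn) ?_
      · intro x; simp; have := x.2; omega
      · intro a ha; simp at ha; refine ⟨⟨a, by omega⟩, by simp; omega, rfl⟩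
    · intro x hx
      simp only [mem_filter, mem_univ, true_and] at hx ⊢
      have hx0 : x ≠ 0 := by rintro rfl; simp at hx
      rw [Fin.val_neg, if_neg hx0]
      have := x.2
      omega

instance : MeasurableSingletonClass (SimpleGraph (Fin n)) where
  measurableSet_singleton G := by
    have : {G} = SimpleGraph.Adj ⁻¹' {G.Adj} := by
      ext G'; exact SimpleGraph.adj_inj.symm
    rw [this]
    exact SimpleGraph.measurable_adj (measurableSet_singleton _)

theorem withHighProb_of_forall_isRegular {r : ℕ} {P : (n : ℕ) → SimpleGraph (Fin n) → Prop}
    (hP : ∀ n, r < n → 2 ≤ n → ∀ G : SimpleGraph (Fin n), IsRegular G r → P n G) :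
    WithHighProb r P := by
  refine Filter.Tendsto.congr' ?_ tendsto_const_nhds
  rw [Filter.EventuallyEq, Filter.eventually_inf_principal]
  filter_upwards [Filter.eventually_ge_atTop 2] with n hn ⟨hrn, he⟩
  symm
  exact ProbabilityTheory.uniformOn_eq_one_of (Set.toFinite _) (exists_isRegular hrn he)
    fun G hG => hP n hrn hn G hG

/-! ### Single flips in connected regular graphs -/

theorem exists_adj_mem_notMem {G : SimpleGraph (Fin n)} (hc : G.Connected)
    {A : Finset (Fin n)} (hA : A.Nonempty) (hA' : #A < n) : ∃ v ∈ A, ∃ w ∉ A, G.Adj v w := by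
  obtain ⟨a, ha⟩ := hA
  obtain ⟨b, hb⟩ : ∃ b, b ∉ A := by
    by_contra! h
    have : A = univ := eq_univ_of_forall h
    simp [this] at hA'
  obtain ⟨p⟩ := hc.preconnected a b
  obtain ⟨d, -, h1, h2⟩ := p.exists_boundary_dart (A : Set (Fin n)) ha hb
  exact ⟨d.fst, h1, d.snd, h2, d.adj⟩

theorem degreeIn_pos {G : SimpleGraph (Fin n)} {v w : Fin n} {A : Finset (Fin n)} (hw : w ∈ A)
    (h : G.Adj v w) : 1 ≤ degreeIn G v A :=
  card_pos.2 ⟨w, by simp [hw, h]⟩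

theorem card_edgeBoundary_pos {G : SimpleGraph (Fin n)} {v w : Fin n} {A : Finset (Fin n)}
    (hv : v ∈ A) (hw : w ∉ A) (h : G.Adj v w) : 0 < #(edgeBoundary G A) :=
  card_pos.2 ⟨(v, w), by simp [edgeBoundary, hv, hw, h]⟩

/-- An edge `{a, w}` has boundary at most `2r - 2`, and connectivity makes it positive once there is
a third vertex. -/
theorem two_le_of_connected {G : SimpleGraph (Fin n)} {r : ℕ} (hG : IsRegular G r)
    (hc : G.Connected) (hn : 3 ≤ n) : 2 ≤ r := by
  let a : Fin n := ⟨0, by omega⟩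
  obtain ⟨v, hv, w, hw, hvw⟩ := exists_adj_mem_notMem hc (singleton_nonempty a) (by simp; omega)
  rw [mem_singleton.1 hv] at hvw
  have h1 := card_edgeBoundary_insert hG (notMem_empty a)
  have h2 := card_edgeBoundary_insert hG hw
  have h3 := degreeIn_pos (mem_singleton_self a) hvw.symm
  obtain ⟨x, hx, y, hy, hxy⟩ := exists_adj_mem_notMem (A := insert w {a}) hc (by simp)
    (by rw [card_insert_of_notMem hw]; simp; omega)
  have h4 := card_edgeBoundary_pos hx hy hxy
  have h5 : #(edgeBoundary G ∅) = 0 := by simp [edgeBoundary]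
  rw [h5, insert_empty_eq] at h1
  omega

theorem degreeIn_compl_eq {G : SimpleGraph (Fin n)} {r : ℕ} (hG : IsRegular G r)
    (v : Fin n) (A : Finset (Fin n)) : (degreeIn G v Aᶜ : ℝ) = r - degreeIn G v A := by
  rw [eq_sub_iff_add_eq']
  exact_mod_cast degreeIn_add_degreeIn_compl hG v A

theorem energy_erase {G : SimpleGraph (Fin n)} {r : ℕ} (hG : IsRegular G r) (h : ℝ)
    {v : Fin n} {A : Finset (Fin n)} (hv : v ∈ A) :
    energy G h (A.erase v) = energy G h A + 2 * (r - 2 * degreeIn G v Aᶜ + h) := by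
  have h1 := energy_insert hG h (notMem_erase v A)
  have h2 := degreeIn_insert_self G v (A.erase v)
  rw [insert_erase hv] at h1 h2
  rw [degreeIn_compl_eq hG, h1, h2]
  ring

section Steps

variable {G : SimpleGraph (Fin n)} {r : ℕ} (hG : IsRegular G r) {h : ℝ} {A : Finset (Fin n)}
include hG

theorem exists_energy_erase_le_add (hc : G.Connected) (hA : A.Nonempty) (hA' : #A < n) :
    ∃ v ∈ A, energy G h (A.erase v) ≤ energy G h A + 2 * (r - 2 + h) := by
  obtain ⟨v, hv, w, hw, hvw⟩ := exists_adj_mem_notMem hc hA hA'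
  have : (1 : ℝ) ≤ degreeIn G v Aᶜ := by
    exact_mod_cast degreeIn_pos (mem_compl.2 hw) hvw
  exact ⟨v, hv, by rw [energy_erase hG h hv]; linarith⟩

theorem exists_energy_insert_le_add (h0 : 0 ≤ h) (hc : G.Connected) (hA : A.Nonempty)
    (hA' : #A < n) :
    ∃ v ∉ A, energy G h (insert v A) ≤ energy G h A + 2 * (r - 2 + h) := by
  obtain ⟨v, hv, w, hw, hvw⟩ := exists_adj_mem_notMem hc hA hA'
  have : (1 : ℝ) ≤ degreeIn G w A := by exact_mod_cast degreeIn_pos hv hvw.symm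
  exact ⟨w, hw, by rw [energy_insert hG h hw]; linarith⟩

/-- If every removal costs energy, each vertex of `A` has fewer than `(r + h) / 2` neighbours
outside; sum over `A`. -/
theorem energy_le_of_forall_lt_erase
    (H : ∀ v ∈ A, energy G h A < energy G h (A.erase v)) :
    energy G h A ≤ #A * (r - h) := by
  have h1 : (#(edgeBoundary G A) : ℝ) ≤ #A • ((r + h) / 2 : ℝ) := by
    rw [card_edgeBoundary_eq_sum]
    push_cast
    refine sum_le_card_nsmul _ _ _ fun v hv => ?_
    have := H v hv
    rw [energy_erase hG h hv] at this
    linarith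
  rw [nsmul_eq_mul] at h1
  rw [energy]
  linarith

/-- If every insertion costs energy, each outside vertex has fewer than `(r - h) / 2` neighbours in
`A`; sum over `Aᶜ`. -/
theorem energy_le_of_forall_lt_insert
    (H : ∀ v ∉ A, energy G h A < energy G h (insert v A)) :
    energy G h A ≤ (n - #A) * (r - h) - 2 * h * #A := by
  have hA : #A ≤ n := by simpa using card_le_univ A
  have h1 : (#(edgeBoundary G A) : ℝ) ≤ #Aᶜ • ((r - h) / 2 : ℝ) := by
    rw [card_edgeBoundary_eq_sum_compl]
    push_cast
    refine sum_le_card_nsmul _ _ _ fun v hv => ?_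
    rw [mem_compl] at hv
    have := H v hv
    rw [energy_insert hG h hv] at this
    linarith
  rw [nsmul_eq_mul, card_compl, Fintype.card_fin, Nat.cast_sub hA] at h1
  rw [energy]
  linarith

end Steps

/-! ### Paths from a starting set to both ends -/

section Paths

variable {G : SimpleGraph (Fin n)} {r : ℕ} (hG : IsRegular G r) (hc : G.Connected) {h F : ℝ}
  {K : ℕ} (hK : 1 ≤ K) (hD : 0 ≤ (r : ℝ) - 2 + h) {A₀ : Finset (Fin n)}
  (hF : energy G h A₀ ≤ F) (hr : 0 ≤ (r : ℝ) - h)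
include hG hc hK hD hF hr

theorem reflTransGen_empty (hA₀ : #A₀ < n) (hb : ((#A₀ : ℝ) - K) * (r - h) ≤ F) :
    ReflTransGen (UpStep G h (F + 2 * (r - 2 + h) * K)) ∅ A₀ := by
  -- The `min` lets the ceiling rise for `K` flips and then freezes it.
  have key : ∀ k ≤ #A₀, ∃ A, #A + k = #A₀ ∧
      energy G h A ≤ F + 2 * (r - 2 + h) * (min k K : ℕ) ∧
      ReflTransGen (UpStep G h (F + 2 * (r - 2 + h) * K)) A A₀ := by
    intro k hk
    induction k with
    | zero => exact ⟨A₀, rfl, by simpa using hF, .refl⟩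
    | succ k ih =>
      obtain ⟨A, hA, hE, hp⟩ := ih (by omega)
      have hne : A.Nonempty := card_pos.1 (by omega)
      have hmin : ∀ j : ℕ, F + 2 * (r - 2 + h) * (min j K : ℕ) ≤ F + 2 * (r - 2 + h) * K := by
        intro j; gcongr; exact min_le_right _ _
      suffices H : ∃ v ∈ A, energy G h (A.erase v) ≤
          F + 2 * (r - 2 + h) * (min (k + 1) K : ℕ) by
        obtain ⟨v, hv, hle⟩ := H
        exact ⟨A.erase v, by rw [card_erase_of_mem hv]; omega, hle,
          hp.head ⟨⟨v, notMem_erase v A, (insert_erase hv).symm⟩, hle.trans (hmin _),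
            hE.trans (hmin _)⟩⟩
      obtain ⟨v, hv, hle⟩ := exists_energy_erase_le_add (h := h) hG hc hne (by omega)
      rcases Nat.lt_or_ge k K with hkK | hkK
      · rw [min_eq_left hkK.le] at hE
        refine ⟨v, hv, ?_⟩
        rw [min_eq_left hkK]
        push_cast
        linarith
      · rw [min_eq_right hkK] at hE
        rw [min_eq_right (by omega)]
        by_cases H : ∀ v ∈ A, energy G h A < energy G h (A.erase v)
        · have h1 := energy_le_of_forall_lt_erase hG H
          have h2 : (#A : ℝ) ≤ #A₀ - K := by
            have : ((#A + K : ℕ) : ℝ) ≤ #A₀ := by exact_mod_cast (by omega : #A + K ≤ #A₀)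
            push_cast at this; linarith
          have h3 := mul_le_mul_of_nonneg_right h2 hr
          -- At a local minimum the energy is already at most `F`, and `K ≥ 1` pays for one climb.
          have h4 : 2 * ((r : ℝ) - 2 + h) * 1 ≤ 2 * (r - 2 + h) * K := by
            gcongr; exact_mod_cast hK
          exact ⟨v, hv, by linarith⟩
        · push Not at H
          obtain ⟨w, hw, hle⟩ := H
          exact ⟨w, hw, hle.trans hE⟩
  obtain ⟨A, hA, -, hp⟩ := key _ le_rfl
  have : A = ∅ := card_eq_zero.1 (by omega)
  exact this ▸ hp

theorem reflTransGen_univ (h0 : 0 ≤ h) (hA₀ : A₀.Nonempty)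
    (hb : ((n : ℝ) - #A₀ - K) * (r - h) - 2 * h * #A₀ ≤ F) :
    ReflTransGen (UpStep G h (F + 2 * (r - 2 + h) * K)) A₀ univ := by
  have key : ∀ k, #A₀ + k ≤ n → ∃ A, #A = #A₀ + k ∧
      energy G h A ≤ F + 2 * (r - 2 + h) * (min k K : ℕ) ∧
      ReflTransGen (UpStep G h (F + 2 * (r - 2 + h) * K)) A₀ A := by
    intro k hk
    induction k with
    | zero => exact ⟨A₀, rfl, by simpa using hF, .refl⟩
    | succ k ih =>
      obtain ⟨A, hA, hE, hp⟩ := ih (by omega)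
      have hne : A.Nonempty := card_pos.1 (by have := card_pos.2 hA₀; omega)
      have hmin : ∀ j : ℕ, F + 2 * (r - 2 + h) * (min j K : ℕ) ≤ F + 2 * (r - 2 + h) * K := by
        intro j; gcongr; exact min_le_right _ _
      suffices H : ∃ v ∉ A, energy G h (insert v A) ≤
          F + 2 * (r - 2 + h) * (min (k + 1) K : ℕ) by
        obtain ⟨v, hv, hle⟩ := H
        exact ⟨insert v A, by rw [card_insert_of_notMem hv]; omega, hle,
          hp.tail ⟨⟨v, hv, rfl⟩, hE.trans (hmin _), hle.trans (hmin _)⟩⟩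
      obtain ⟨v, hv, hle⟩ := exists_energy_insert_le_add hG h0 hc hne (by omega)
      rcases Nat.lt_or_ge k K with hkK | hkK
      · rw [min_eq_left hkK.le] at hE
        refine ⟨v, hv, ?_⟩
        rw [min_eq_left hkK]
        push_cast
        linarith
      · rw [min_eq_right hkK] at hE
        rw [min_eq_right (by omega)]
        by_cases H : ∀ v ∉ A, energy G h A < energy G h (insert v A)
        · have h1 := energy_le_of_forall_lt_insert hG H
          have h2 : (n : ℝ) - #A ≤ n - #A₀ - K := by
            have : ((#A₀ + K : ℕ) : ℝ) ≤ #A := by exact_mod_cast (by omega : #A₀ + K ≤ #A)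
            push_cast at this; linarith
          have h3 := mul_le_mul_of_nonneg_right h2 hr
          have h4 : 2 * ((r : ℝ) - 2 + h) * 1 ≤ 2 * (r - 2 + h) * K := by
            gcongr; exact_mod_cast hK
          have h5 : 2 * h * (#A₀ : ℝ) ≤ 2 * h * #A :=
            mul_le_mul_of_nonneg_left (Nat.cast_le.2 (by omega)) (by linarith)
          exact ⟨v, hv, by linarith⟩
        · push Not at H
          obtain ⟨w, hw, hle⟩ := H
          exact ⟨w, hw, hle.trans hE⟩
  have hA₀n : #A₀ ≤ n := by simpa using card_le_univ A₀
  obtain ⟨A, hA, -, hp⟩ := key (n - #A₀) (by omega)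
  have : A = univ := by rw [← card_eq_iff_eq_univ, hA, Fintype.card_fin]; omega
  exact this ▸ hp

end Paths

/-! ### Isoperimetric constants and the bound in (a) -/

theorem isoNumber_mul_le (G : SimpleGraph (Fin n)) {A : Finset (Fin n)} (hA : A.Nonempty)
    (hA' : 2 * #A ≤ n) : isoNumber G * #A ≤ #(edgeBoundary G A) := by
  have hpos : (0 : ℝ) < #A := by exact_mod_cast card_pos.2 hA
  rw [← le_div_iff₀ hpos]
  refine csInf_le ⟨0, ?_⟩ ⟨A, hA, hA', rfl⟩
  rintro _ ⟨B, -, -, rfl⟩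
  positivity

theorem exists_bisectionNumber_eq (G : SimpleGraph (Fin n)) :
    ∃ A : Finset (Fin n), #A = n / 2 ∧
      bisectionNumber G = (#(edgeBoundary G A) : ℝ) / #A := by
  refine Set.Nonempty.csInf_mem (s := {x : ℝ | ∃ A : Finset (Fin n), #A = n / 2 ∧
    x = (#(edgeBoundary G A) : ℝ) / #A}) ?_ ?_
  · obtain ⟨A, -, hA⟩ := exists_subset_card_eq (s := (univ : Finset (Fin n))) (n := n / 2)
      (by simp; omega)
    exact ⟨_, A, hA, rfl⟩
  · refine (Set.finite_range fun A : Finset (Fin n) =>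
      (#(edgeBoundary G A) : ℝ) / #A).subset ?_
    rintro _ ⟨A, -, rfl⟩
    exact ⟨A, rfl⟩

/-- The averaging path at size `⌊n/2⌋` gives `2 i_e ≤ r (n + 1) / (n - 1)`; large `n` makes the
excess over `r` less than `h`. This ensures that the ceiling in (a) is at least 1. -/
theorem two_mul_isoNumber_lt {G : SimpleGraph (Fin n)} {r : ℕ} (hG : IsRegular G r) {h : ℝ}
    (h0 : 0 < h) (hn : 2 ≤ n) (hnh : 2 * r + h < h * n) : 2 * isoNumber G < r + h := by
  have hn1 : (0 : ℝ) < n - 1 := by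
    have : (2 : ℝ) ≤ n := by exact_mod_cast hn
    linarith
  obtain ⟨A, hA, hb, -⟩ := exists_reflTransGen_card_eq (M := (r : ℝ) * n ^ 2 / (2 * (n - 1)))
    hG h0.le hn (by field_simp; rfl) (Nat.div_le_self n 2)
  rw [← hA] at hb
  have hm : 0 < #A := by omega
  have hi := isoNumber_mul_le G (card_pos.1 hm) (by omega)
  have hm' : (0 : ℝ) < #A := by exact_mod_cast hm
  have h1 : isoNumber G * (n - 1) ≤ r * (n - #A) := by
    refine le_of_mul_le_mul_right ?_ hm'
    have := mul_le_mul_of_nonneg_right hi hn1.le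
    linarith
  have h2 : (n : ℝ) ≤ 2 * #A + 1 := by exact_mod_cast (by omega : n ≤ 2 * #A + 1)
  have h3 : (r : ℝ) * n ≤ r * (2 * #A + 1) := by gcongr
  refine lt_of_mul_lt_mul_right ?_ hn1.le
  linarith

theorem commHeight_sub_le_of_connected {G : SimpleGraph (Fin n)} {r : ℕ} (hG : IsRegular G r)
    (hc : G.Connected) {h : ℝ} (h0 : 0 < h) (hn : 3 ≤ n) (hnh : 2 * r + h < h * n)
    (hi : h < isoNumber G) :
    commHeight G h (allMinus n) (allPlus n) - hamiltonian G h (allMinus n)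
      ≤ (bisectionNumber G - h) * n + 2 * ((r : ℝ) - 2 + h) *
        (⌈((r : ℝ) + h - 2 * isoNumber G) / (r - h) * (n / 2)⌉ : ℝ) := by
  have hi2 := two_mul_isoNumber_lt hG h0 (by omega) hnh
  have hr2 : (2 : ℝ) ≤ r := by exact_mod_cast two_le_of_connected hG hc hn
  -- From `2h < 2 i_e < r + h`.
  have hrh : 0 < (r : ℝ) - h := by linarith
  have hn0 : (0 : ℝ) < n := by exact_mod_cast (by omega : 0 < n)
  set x := ((r : ℝ) + h - 2 * isoNumber G) / (r - h) * (n / 2) with hx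
  have hx0 : 0 < x := by
    have : 0 < (r : ℝ) + h - 2 * isoNumber G := by linarith
    positivity
  obtain ⟨K, hK⟩ := Int.eq_ofNat_of_zero_le (Int.ceil_pos.2 hx0).le
  have hK1 : 1 ≤ K := by have := Int.ceil_pos.2 hx0; omega
  have hxK : x ≤ K := by have := Int.le_ceil x; rwa [hK] at this
  have hKr : (r + h - 2 * isoNumber G) * (n / 2) ≤ K * (r - h) := by
    have := mul_le_mul_of_nonneg_right hxK hrh.le
    rwa [hx, mul_right_comm, div_mul_cancel₀ _ hrh.ne'] at this
  obtain ⟨A, hA, hbis⟩ := exists_bisectionNumber_eq G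
  have hAne : A.Nonempty := card_pos.1 (by omega)
  have hm : (0 : ℝ) < #A := by exact_mod_cast card_pos.2 hAne
  have hiso := isoNumber_mul_le G hAne (by omega)
  have hbis' : bisectionNumber G * #A = #(edgeBoundary G A) := by
    rw [hbis, div_mul_cancel₀ _ hm.ne']
  have hib : isoNumber G ≤ bisectionNumber G := by
    rwa [hbis, le_div_iff₀ hm]
  have h2m : 2 * (#A : ℝ) ≤ n := by exact_mod_cast (by omega : 2 * #A ≤ n)
  have h2m' : (n : ℝ) ≤ 2 * #A + 1 := by exact_mod_cast (by omega : n ≤ 2 * #A + 1)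
  have hE : energy G h A = 2 * (bisectionNumber G - h) * #A := by
    rw [energy, ← hbis']; ring
  have hEi : 2 * (isoNumber G - h) * #A ≤ energy G h A := by
    rw [hE]; gcongr
  have hD : 0 ≤ (r : ℝ) - 2 + h := by linarith
  have p1 := reflTransGen_empty hG hc hK1 hD le_rfl hrh.le (A₀ := A) (by omega) (by
    have := mul_le_mul_of_nonneg_left h2m (by linarith : 0 ≤ (r : ℝ) + h - 2 * isoNumber G)
    linarith)
  -- For odd `n` the complement has one extra vertex; the gain `h n` from the field absorbs it, by
  -- `hnh`.
  have p2 := reflTransGen_univ hG hc hK1 hD le_rfl hrh.le h0.le hAne (by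
    have := mul_le_mul_of_nonneg_left h2m' (by linarith : 0 ≤ (r : ℝ) - h + 2 * isoNumber G)
    have := mul_le_mul_of_nonneg_left h2m h0.le
    linarith)
  refine (commHeight_sub_le (by omega) (p1.trans p2)).trans ?_
  rw [hK, Int.cast_natCast]
  gcongr
  rw [hE]
  have := mul_le_mul_of_nonneg_left h2m (by linarith : 0 ≤ bisectionNumber G - h)
  linarith

end IsingRegular

theorem proposition4p5 :
    (∀ (r : ℕ) (h : ℝ), 0 < h → ∃ n₀ : ℕ, ∀ n : ℕ, n₀ ≤ n → ∀ G : SimpleGraph (Fin n),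
      G.Connected → IsingRegular.IsRegular G r → h < IsingRegular.isoNumber G →
        IsingRegular.commHeight G h (IsingRegular.allMinus n) (IsingRegular.allPlus n)
            - IsingRegular.hamiltonian G h (IsingRegular.allMinus n)
          ≤ (IsingRegular.bisectionNumber G - h) * (n : ℝ)
            + 2 * ((r : ℝ) - 2 + h) *
              (⌈((r : ℝ) + h - 2 * IsingRegular.isoNumber G) / ((r : ℝ) - h) * ((n : ℝ) / 2)⌉ : ℝ))
    ∧
    (∃ C₀ C₂ : ℝ, 0 < C₀ ∧ ∀ (r : ℕ) (h : ℝ), 0 < h → h < C₀ * Real.sqrt (r : ℝ) →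
      IsingRegular.WithHighProb r fun n G =>
        IsingRegular.commHeight G h (IsingRegular.allMinus n) (IsingRegular.allPlus n)
            - IsingRegular.hamiltonian G h (IsingRegular.allMinus n)
          ≤ ((r : ℝ) / 2 + C₂ * Real.sqrt (r : ℝ)) * (n : ℝ)) := by
  refine ⟨fun r h h0 => ?_, 1, 1, one_pos, fun r h h0 hr => ?_⟩
  · obtain ⟨N, hN⟩ := exists_nat_gt ((2 * r + h) / h)
    refine ⟨max 3 N, fun n hn G hc hG hi => ?_⟩
    have hNn : (N : ℝ) ≤ n := by exact_mod_cast (le_max_right _ _).trans hn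
    refine IsingRegular.commHeight_sub_le_of_connected hG hc h0 ((le_max_left _ _).trans hn) ?_ hi
    rw [mul_comm h]
    exact (div_lt_iff₀ h0).1 (hN.trans_le hNn)
  · refine IsingRegular.withHighProb_of_forall_isRegular fun n hrn hn G hG => ?_
    refine IsingRegular.commHeight_sub_le_of_isRegular hG h0.le hn ?_
    have hn' : (2 : ℝ) ≤ n := by exact_mod_cast hn
    have hrn' : (r : ℝ) ≤ n - 1 := by
      have : ((r + 1 : ℕ) : ℝ) ≤ n := by exact_mod_cast hrn
      push_cast at this; linarith
    -- As `√r ≤ n - 1`, the excess of `r n² / (2 (n - 1))` over `r n / 2` is at most `√r n`.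
    have hs : (r : ℝ) ≤ Real.sqrt r * (n - 1) := by
      have h1 := Real.mul_self_sqrt (Nat.cast_nonneg (α := ℝ) r)
      have h2 : Real.sqrt r ≤ n - 1 := Real.sqrt_le_iff.2 ⟨by linarith, by nlinarith⟩
      nlinarith [Real.sqrt_nonneg (r : ℝ)]
    nlinarith [mul_le_mul_of_nonneg_left hs (by linarith : (0 : ℝ) ≤ n)]
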